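/- Let $K\subset\mathbb{R}$ be a real quadratic field with ring of integers $\mathcal{O}_K$ and norm $N=N_{K/\mathbb{Q}}$, let $\alpha\in\mathcal{O}_K^{\times}$ be a unit with $\alpha>0$ and $\alpha\neq\pm1$, and let $\Delta_n=N(\alpha^n-1)\in\mathbb{Z}$ for $n\geq 1$. A primitive prime divisor of $\Delta_n$ is a prime $p$ such that $p\mid\Delta_n$ and $p\nmid\Delta_m$ for every $1\leq m<n$ with $\Delta_m\neq 0$. (1) If $N(\alpha)=1$, then $\Delta_n$ has a primitive prime divisor for every $n>12$. (2) If $N(\alpha)=-1$, then for every $n>24$, $\Delta_n$ has no primitive prime divisor if and only if $n\equiv 2\pmod 4$. -/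

import Mathlib

open scoped NumberField

/-- For an integer sequence `(a n)` indexed by `n ≥ 1`, the prime `p` is a primitive prime divisor
of the term `a n`: it divides `a n`, and it divides no earlier nonzero term. -/
def IsPrimitivePrimeDivisor (a : ℕ → ℤ) (n p : ℕ) : Prop :=
  p.Prime ∧ (p : ℤ) ∣ a n ∧ ∀ m : ℕ, 1 ≤ m → m < n → a m ≠ 0 → ¬ (p : ℤ) ∣ a m

/-- The term `a n` has a primitive prime divisor. -/
def HasPrimitivePrimeDivisor (a : ℕ → ℤ) (n : ℕ) : Prop :=
  ∃ p : ℕ, IsPrimitivePrimeDivisor a n p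

/-- The Lehmer-Pierce sequence `Δ n = N(α ^ n - 1)` of an algebraic integer `α` of `K`.
The norm from `𝓞 K` to `ℤ` is the field norm of `K` over `ℚ`, as an integer. -/
noncomputable def lehmerPierce {K : Type*} [Field K] [NumberField K] (α : 𝓞 K) (n : ℕ) : ℤ :=
  Algebra.norm ℤ (α ^ n - 1)

theorem lehmerPierce_cast {K : Type*} [Field K] [NumberField K] (α : 𝓞 K) (n : ℕ) :
    (lehmerPierce α n : ℚ) = Algebra.norm ℚ ((α : K) ^ n - 1) := by
  simp [lehmerPierce, Algebra.coe_norm_int]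

/-!
An element `g` of norm `1` satisfies `(g - 1) ^ 2 = -N(g - 1) * g`. Applied to the powers of `a`,
this identity shows that `p ∣ Δ m` exactly when `a ^ m = 1` in a field of characteristic `p`, that
the order of `a` there is at most `p + 1`, and that `a > 1` forces `a > 13 / 5`.

Let `N(a) = 1` and suppose that `Δ n` has no primitive prime divisor. A prime `p` dividing
`N(Φ_n(a))` then divides `n`, and the prime-to-`p` part of `n` is the order of `a` modulo `p`, hence
at most `p + 1`. For `n > 12` this leaves a single prime `p`, and expanding the geometric sum with
ratio `a ^ (n / p)` and `p` terms, which `Φ_n(a)` divides, shows `p ^ 3 ∤ N(Φ_n(a))`. So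
`|N(Φ_n(a))| ≤ p ^ 2 ≤ (φ(n) + 1) ^ 2`, whereas Möbius inversion gives
`|N(Φ_n(a))| > (13 / 5) ^ φ(n) / 5`.

If `N(a) = -1`, the first case is applied to `a ^ 2`, using `Δ (2 * m) = -(Δ m) ^ 2` for odd `m`.
-/

open Polynomial

universe u

/-! ### Real lower bounds for cyclotomic values -/

theorem one_sub_sub_sq_lt_prod_one_sub_pow {b : ℝ} (hb : 0 < b) (hb1 : b ≤ 1) {n : ℕ}
    (hn : 0 < n) :
    1 - b - b ^ 2 < ∏ d ∈ Finset.Icc 1 n, (1 - b ^ d) := by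
  -- The term `b ^ (n + 1)` makes the induction close.
  suffices h : 1 - b - b ^ 2 + b ^ (n + 1) ≤ ∏ d ∈ Finset.Icc 1 n, (1 - b ^ d) from
    (lt_add_of_pos_right _ (pow_pos hb _)).trans_le h
  induction n, hn using Nat.le_induction with
  | base => simp
  | succ n hn ih =>
    rw [Finset.prod_Icc_succ_top (by omega)]
    have hb1' : 0 ≤ 1 - b ^ (n + 1) := sub_nonneg.mpr (pow_le_one₀ hb.le hb1)
    have hpow : b ^ (n + 1) * b ^ (n + 1) ≤ b ^ (n + 1) * b ^ 2 :=
      mul_le_mul_of_nonneg_left (pow_le_pow_of_le_one hb.le hb1 (by omega)) (pow_pos hb _).le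
    calc 1 - b - b ^ 2 + b ^ (n + 1 + 1)
      _ ≤ (1 - b - b ^ 2 + b ^ (n + 1)) * (1 - b ^ (n + 1)) := by linarith [pow_succ b (n + 1)]
      _ ≤ _ := mul_le_mul_of_nonneg_right ih hb1'

theorem self_le_zpow_moebius {u : ℝ} (h0 : 0 < u) (h1 : u ≤ 1) (n : ℕ) :
    u ≤ u ^ ArithmeticFunction.moebius n := by
  rcases ArithmeticFunction.moebius_eq_or n with h | h | h <;> rw [h]
  · simpa only [zpow_zero] using h1
  · rw [zpow_one]
  · rw [zpow_neg_one]
    exact h1.trans ((one_le_inv₀ h0).mpr h1)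

theorem one_sub_sub_sq_lt_of_prod_divisors_eq {b : ℝ} (hb0 : 0 < b) (hb1 : b < 1) {F : ℕ → ℝ}
    (hF : ∀ n > 0, ∏ d ∈ n.divisors, F d = 1 - b ^ n) {n : ℕ} (hn : 0 < n) :
    1 - b - b ^ 2 < F n := by
  have hpos : ∀ m > 0, 0 < 1 - b ^ m := fun m hm ↦
    sub_pos.mpr (pow_lt_one₀ hb0.le hb1 hm.ne')
  have hle : ∀ m, 1 - b ^ m ≤ 1 := fun m ↦ sub_le_self 1 (pow_pos hb0 m).le
  have hF0 : ∀ m > 0, F m ≠ 0 := fun m hm ↦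
    Finset.prod_ne_zero_iff.mp ((hF m hm).trans_ne (hpos m hm).ne') m
      (Nat.mem_divisors_self m hm.ne')
  have hinv := (ArithmeticFunction.prod_eq_iff_prod_pow_moebius_eq_of_nonzero hF0
    fun m hm ↦ (hpos m hm).ne').mp hF n hn
  -- All factors being at most `1`, raising each Möbius exponent to `1` and inserting the missing
  -- indices only decreases the product.
  calc 1 - b - b ^ 2
    _ < ∏ d ∈ Finset.Icc 1 n, (1 - b ^ d) := one_sub_sub_sq_lt_prod_one_sub_pow hb0 hb1.le hn
    _ ≤ ∏ d ∈ n.divisors, (1 - b ^ d) :=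
      Finset.prod_le_prod_of_subset_of_le_one (Finset.filter_subset _ _)
        (fun d hd ↦ (hpos d (Finset.mem_Icc.mp hd).1).le) fun d _ _ ↦ hle d
    _ = ∏ x ∈ n.divisorsAntidiagonal, (1 - b ^ x.2) :=
      (Nat.prod_divisorsAntidiagonal' fun _ d ↦ 1 - b ^ d).symm
    _ ≤ ∏ x ∈ n.divisorsAntidiagonal, (1 - b ^ x.2) ^ ArithmeticFunction.moebius x.1 := by
      have hpos' : ∀ x ∈ n.divisorsAntidiagonal, 0 < 1 - b ^ x.2 := fun x hx ↦
        hpos _ (Nat.pos_of_ne_zero (Nat.ne_zero_of_mem_divisorsAntidiagonal hx).2)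
      exact Finset.prod_le_prod (fun x hx ↦ (hpos' x hx).le) fun x hx ↦
        self_le_zpow_moebius (hpos' x hx) (hle _) _
    _ = F n := hinv

theorem prod_divisors_eval_cyclotomic {R : Type*} [CommRing R] (x : R) {n : ℕ} (hn : 0 < n) :
    ∏ d ∈ n.divisors, (cyclotomic d R).eval x = x ^ n - 1 := by
  simpa only [eval_prod, eval_sub, eval_pow, eval_X, eval_one] using
    congrArg (eval x) (prod_cyclotomic_eq_X_pow_sub_one hn R)

theorem one_sub_sub_sq_lt_eval_cyclotomic_inv_mul_pow {b : ℝ} (hb0 : 0 < b) (hb1 : b < 1) {n : ℕ}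
    (hn : 0 < n) : 1 - b - b ^ 2 < (cyclotomic n ℝ).eval b⁻¹ * b ^ n.totient := by
  refine one_sub_sub_sq_lt_of_prod_divisors_eq hb0 hb1
    (F := fun d ↦ (cyclotomic d ℝ).eval b⁻¹ * b ^ d.totient) (fun m hm ↦ ?_) hn
  rw [Finset.prod_mul_distrib, prod_divisors_eval_cyclotomic _ hm, Finset.prod_pow_eq_pow_sum,
    Nat.sum_totient, sub_mul, ← mul_pow, inv_mul_cancel₀ hb0.ne', one_pow, one_mul]

theorem one_sub_sub_sq_lt_abs_eval_cyclotomic {b : ℝ} (hb0 : 0 < b) (hb1 : b < 1) {n : ℕ}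
    (hn : 0 < n) : 1 - b - b ^ 2 < |(cyclotomic n ℝ).eval b| := by
  refine one_sub_sub_sq_lt_of_prod_divisors_eq hb0 hb1
    (F := fun d ↦ |(cyclotomic d ℝ).eval b|) (fun m hm ↦ ?_) hn
  rw [← Finset.abs_prod, prod_divisors_eval_cyclotomic b hm, abs_sub_comm, abs_of_nonneg]
  exact sub_nonneg.mpr (pow_le_one₀ hb0.le hb1.le)

theorem pow_totient_div_five_lt_abs_eval_cyclotomic_mul {x : ℝ} (hx : 13 / 5 ≤ x) {n : ℕ}
    (hn : 0 < n) :
    (13 / 5) ^ n.totient / 5 < |(cyclotomic n ℝ).eval x * (cyclotomic n ℝ).eval x⁻¹| := by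
  have hx1 : 1 < x := by linarith
  have hx0 : 0 < x := by linarith
  have hb0 : 0 < x⁻¹ := inv_pos.mpr hx0
  have hb : x⁻¹ ≤ 5 / 13 := by simpa only [inv_div] using inv_anti₀ (by norm_num) hx
  have hb1 : x⁻¹ < 1 := by linarith
  have hc : 79 / 169 ≤ 1 - x⁻¹ - x⁻¹ ^ 2 := by nlinarith
  have hA := hc.trans_lt (one_sub_sub_sq_lt_eval_cyclotomic_inv_mul_pow hb0 hb1 hn)
  have hB := hc.trans_lt (one_sub_sub_sq_lt_abs_eval_cyclotomic hb0 hb1 hn)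
  rw [inv_inv] at hA
  have hAB : 1 / 5 < (cyclotomic n ℝ).eval x * x⁻¹ ^ n.totient * |(cyclotomic n ℝ).eval x⁻¹| :=
    (by norm_num : (1 / 5 : ℝ) < 79 / 169 * (79 / 169)).trans
      (mul_lt_mul'' hA hB (by norm_num) (by norm_num))
  have hpow : x ^ n.totient * x⁻¹ ^ n.totient = 1 := by
    rw [← mul_pow, mul_inv_cancel₀ hx0.ne', one_pow]
  calc (13 / 5) ^ n.totient / 5
    _ ≤ x ^ n.totient * (1 / 5) := by
      rw [mul_one_div]
      gcongr
    _ < x ^ n.totient *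
          ((cyclotomic n ℝ).eval x * x⁻¹ ^ n.totient * |(cyclotomic n ℝ).eval x⁻¹|) := by
      gcongr
    _ = (cyclotomic n ℝ).eval x * |(cyclotomic n ℝ).eval x⁻¹| := by
      linear_combination (cyclotomic n ℝ).eval x * |(cyclotomic n ℝ).eval x⁻¹| * hpow
    _ = |(cyclotomic n ℝ).eval x * (cyclotomic n ℝ).eval x⁻¹| := by
      rw [abs_mul, abs_of_pos (cyclotomic_pos' n hx1)]

theorem add_one_sq_lt_pow_div_five {m : ℕ} (hm : 6 ≤ m) :
    ((m : ℝ) + 1) ^ 2 < (13 / 5) ^ m / 5 := by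
  induction m, hm using Nat.le_induction with
  | base => norm_num
  | succ m hm ih =>
    have : (6 : ℝ) ≤ m := by exact_mod_cast hm
    rw [pow_succ (13 / 5 : ℝ)]
    push_cast
    nlinarith

/-! ### Arithmetic of the index -/

theorem six_le_totient {n : ℕ} (hn : 12 < n) : 6 ≤ n.totient := by
  by_contra! hlt
  have hdvd : n ∣ 120 := by
    refine (Nat.dvd_iff_prime_pow_dvd_dvd 120 n).mpr fun p k hp hpk ↦ ?_
    rcases k with _ | k
    · exact one_dvd _
    have hle : p ^ k * (p - 1) ≤ 5 := by
      rw [← Nat.totient_prime_pow_succ hp]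
      exact Nat.le_of_lt_succ <| hlt.trans_le' <|
        Nat.le_of_dvd (Nat.totient_pos.mpr (by omega)) (Nat.totient_dvd_of_dvd hpk)
    have hp6 : p - 1 ≤ 5 := (Nat.le_mul_of_pos_left _ (pow_pos hp.pos k)).trans hle
    have hk : k < 3 := by
      by_contra! hk
      have : 2 ^ 3 ≤ p ^ k :=
        (Nat.pow_le_pow_left hp.two_le 3).trans (Nat.pow_le_pow_right hp.pos hk)
      have := Nat.le_mul_of_pos_right (p ^ k) (Nat.sub_pos_of_lt hp.one_lt)
      omega
    have hp2 := hp.two_le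
    have hp6 : p ≤ 6 := by omega
    interval_cases p <;> interval_cases k <;> revert hp hle <;> decide
  have hsmall : ∀ d ∈ Nat.divisors 120, d.totient < 6 → d ≤ 12 := by decide +kernel
  exact hn.not_ge (hsmall n (Nat.mem_divisors.mpr ⟨hdvd, by norm_num⟩) hlt)

theorem eq_of_ordCompl_le_add_one {n p q : ℕ} (hn : 12 < n) (hp : p.Prime) (hq : q.Prime)
    (hpn : p ∣ n) (hqn : q ∣ n) (hrp : ordCompl[p] n ≤ p + 1) (hrq : ordCompl[q] n ≤ q + 1) :
    p = q := by
  wlog hpq : p < q generalizing p q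
  · rcases (not_lt.mp hpq).eq_or_lt with h | h
    · exact h.symm
    · exact (this hq hp hqn hpn hrq hrp h).symm
  have hn0 : n ≠ 0 := by omega
  have hcop : (ordProj[p] n).Coprime (ordProj[q] n) :=
    Nat.Coprime.pow _ _ ((Nat.coprime_primes hp hq).mpr hpq.ne)
  have key : ∀ {l m : ℕ}, (ordProj[l] n).Coprime (ordProj[m] n) → ordProj[m] n ≤ ordCompl[l] n :=
    fun {l m} h ↦ Nat.le_of_dvd (Nat.ordCompl_pos l hn0) <| h.symm.dvd_of_dvd_mul_left <|
      (Nat.ordProj_mul_ordCompl_eq_self n l).symm ▸ Nat.ordProj_dvd n m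
  have hqp : q ≤ p + 1 :=
    (Nat.le_of_dvd (Nat.ordProj_pos n q) (Nat.dvd_ordProj_of_dvd hn0 hq hqn)).trans
      ((key hcop).trans hrp)
  obtain rfl : p = 2 := by
    refine hp.eq_two_or_odd.resolve_right fun hodd ↦ ?_
    have := hp.two_le
    rcases hq.eq_two_or_odd with h | h <;> omega
  have hle : n ≤ (q + 1) * (2 + 1) :=
    (Nat.ordProj_mul_ordCompl_eq_self n 2).symm.le.trans <|
      Nat.mul_le_mul ((key hcop.symm).trans hrq) hrp
  obtain rfl : q = 3 := by omega
  omega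

theorem four_lt_ordProj {n p : ℕ} (hn : 12 < n) (hp : p.Prime) (hpn : p ∣ n)
    (hr : ordCompl[p] n ≤ p + 1) : 4 < ordProj[p] n := by
  by_contra! hle
  have hdvd := Nat.dvd_ordProj_of_dvd (by omega) hp hpn
  have hmul := Nat.ordProj_mul_ordCompl_eq_self n p
  have hp4 := Nat.le_of_dvd (Nat.ordProj_pos n p) hdvd
  have hp2 := hp.two_le
  generalize ordCompl[p] n = r at hr hmul
  generalize ordProj[p] n = P at hle hdvd hmul hp4
  have hp4' : p ≤ 4 := hp4.trans hle
  have hPr := Nat.mul_le_mul_left P hr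
  interval_cases p
  · omega
  · obtain rfl : P = 3 := by omega
    omega
  · exact absurd hp (by norm_num)

/-! ### Cyclotomic polynomials and geometric sums modulo a prime -/

theorem exists_geom_sum_eq_of_pow_eq {R : Type*} [CommRing R] {p : ℕ} (hp : p.Prime) {g z : R}
    (h : (g - 1) ^ (p - 1) = p * z) :
    ∃ y, ∑ i ∈ Finset.range p, g ^ i = p * (1 + (z + (g - 1) * y)) := by
  have hbinom : ∑ i ∈ Finset.range p, g ^ i =
      ∑ i ∈ Finset.range p, (p.choose (i + 1) : R) * (g - 1) ^ i := by
    simpa [eval_comp, eval_finsetSum] using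
      congrArg (eval (g - 1)) (geom_sum_X_comp_X_add_one_eq_sum (R := R) p)
  obtain ⟨q, rfl⟩ : ∃ q, p = q + 2 := ⟨p - 2, by have := hp.two_le; omega⟩
  have hmid : ((q + 2 : ℕ) : R) * (g - 1) ∣
      ∑ i ∈ Finset.range q, ((q + 2).choose (i + 1 + 1) : R) * (g - 1) ^ (i + 1) := by
    refine Finset.dvd_sum fun i hi ↦ mul_dvd_mul ?_ (dvd_pow_self _ i.succ_ne_zero)
    have hi := Finset.mem_range.mp hi
    exact Nat.cast_dvd_cast (hp.dvd_choose_self (by omega) (by omega))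
  obtain ⟨y, hy⟩ := hmid
  refine ⟨y, ?_⟩
  rw [hbinom, Finset.sum_range_succ, Finset.sum_range_succ', hy]
  rw [show q + 2 - 1 = q + 1 by omega] at h
  simp only [zero_add, pow_zero, mul_one, Nat.choose_one_right, Nat.choose_self, Nat.cast_one,
    one_mul, h]
  ring

theorem exists_mem_span_pow_sub_one_eq {R : Type*} [CommRing R] {p : ℕ} (hp : p.Prime) {e : R}
    (he : (p : R) ∣ (e - 1) ^ 2) {j : ℕ} (hj : 4 < p ^ (j + 1)) :
    ∃ z ∈ Ideal.span {(p : R), e - 1}, (e ^ p ^ j - 1) ^ (p - 1) = p * z := by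
  obtain ⟨c, hc⟩ := he
  have hmem : ∀ x y : R, p * x + (e - 1) * y ∈ Ideal.span {(p : R), e - 1} := fun x y ↦
    Ideal.mem_span_pair.mpr ⟨x, y, by ring⟩
  -- For `p ≥ 5` the factor `(e - 1) ^ (p - 1)` suffices; for `p ≤ 3` part of the exponent `p ^ j`
  -- has to supply the missing factor.
  rcases le_or_gt p 3 with hp3 | hp3
  · obtain rfl | rfl : p = 2 ∨ p = 3 := by have := hp.two_le; omega
    · obtain ⟨i, rfl⟩ : ∃ i, j = i + 2 := ⟨j - 2, by
        have : 2 < j + 1 := (Nat.pow_lt_pow_iff_right (by norm_num : 1 < 2)).mp hj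
        omega⟩
      obtain ⟨v, hv⟩ := sub_one_dvd_pow_sub_one (e ^ 4) (2 ^ i)
      have hfour : e ^ 4 - 1 = 2 * (2 * ((e - 1 + c) * (e + c))) := by
        push_cast at hc
        linear_combination (e ^ 2 + 2 * e - 1 + 2 * c) * hc
      refine ⟨_, hmem ((e - 1 + c) * (e + c) * v) 0, ?_⟩
      rw [pow_add, mul_comm (2 ^ i), pow_mul]
      push_cast
      linear_combination hv + v * hfour
    · obtain ⟨i, rfl⟩ : ∃ i, j = i + 1 := ⟨j - 1, by
        rcases j with _ | j <;> omega⟩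
      obtain ⟨v, hv⟩ := sub_one_dvd_pow_sub_one (e ^ 3) (3 ^ i)
      have hthree : e ^ 3 - 1 = 3 * ((e - 1) * (c + e)) := by
        push_cast at hc
        linear_combination (e - 1) * hc
      refine ⟨_, hmem 0 (3 * (e - 1) * ((c + e) * v) ^ 2), ?_⟩
      rw [pow_succ' 3 i, pow_mul, hv, hthree]
      push_cast
      ring
  · obtain ⟨v, hv⟩ := sub_one_dvd_pow_sub_one e (p ^ j)
    refine ⟨_, hmem 0 (c * (e - 1) ^ (p - 4) * v ^ (p - 1)), ?_⟩
    rw [hv, mul_pow, show p - 1 = 2 + (p - 4) + 1 by omega]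
    linear_combination (e - 1) ^ (p - 4 + 1) * v ^ (2 + (p - 4) + 1) * hc

theorem exists_mem_span_geom_sum_eq {R : Type*} [CommRing R] {p : ℕ} (hp : p.Prime) {e : R}
    (he : (p : R) ∣ (e - 1) ^ 2) {j : ℕ} (hj : 4 < p ^ (j + 1)) :
    ∃ w ∈ Ideal.span {(p : R), e - 1},
      ∑ i ∈ Finset.range p, (e ^ p ^ j) ^ i = p * (1 + w) := by
  obtain ⟨z, hz, hpow⟩ := exists_mem_span_pow_sub_one_eq hp he hj
  obtain ⟨y, hy⟩ := exists_geom_sum_eq_of_pow_eq hp hpow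
  refine ⟨_, add_mem hz ?_, hy⟩
  have he_mem : e - 1 ∈ Ideal.span {(p : R), e - 1} :=
    Ideal.subset_span (Set.mem_insert_of_mem _ rfl)
  exact Ideal.mul_mem_right _ _ <| Ideal.mem_of_dvd _ (sub_one_dvd_pow_sub_one e _) he_mem

theorem cyclotomic_mul_dvd_geom_sum (R : Type*) [CommRing R] {d m : ℕ} (hd : 0 < d) (hm : 1 < m) :
    cyclotomic (d * m) R ∣ ∑ i ∈ Finset.range m, (X ^ d) ^ i := by
  have hdvd := X_pow_sub_one_mul_cyclotomic_dvd_X_pow_sub_one_of_dvd R (d := d) (n := d * m)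
    (Nat.mem_properDivisors.mpr ⟨dvd_mul_right d m, lt_mul_of_one_lt_right hd hm⟩)
  rw [pow_mul, ← mul_geom_sum (X ^ d) m] at hdvd
  have hreg : IsLeftRegular (X ^ d - 1 : R[X]) := by
    simpa only [C_1] using (monic_X_pow_sub_C (1 : R) hd.ne').isRegular.left
  exact hreg.dvd_cancel_left.mp hdvd

theorem isPrimitiveRoot_ordCompl_of_isRoot_cyclotomic {F : Type*} [CommRing F] [IsDomain F]
    {p n : ℕ} (hp : p.Prime) [CharP F p] (hn : n ≠ 0) {x : F} (hx : (cyclotomic n F).IsRoot x) :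
    IsPrimitiveRoot x (ordCompl[p] n) := by
  have := Fact.mk hp
  have : NeZero ((ordCompl[p] n : ℕ) : F) :=
    ⟨fun h ↦ Nat.not_dvd_ordCompl hp hn ((CharP.cast_eq_zero_iff F p _).mp h)⟩
  rwa [← Nat.ordProj_mul_ordCompl_eq_self n p, isRoot_cyclotomic_prime_pow_mul_iff_of_charP] at hx

theorem orderOf_le_add_one_of_sub_one_sq_eq {F : Type*} [CommRing F] [IsDomain F] {p : ℕ}
    (hp : p.Prime) [CharP F p] {x : F} {k : ℤ} (hk : (x - 1) ^ 2 = k * x) : orderOf x ≤ p + 1 := by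
  have := Fact.mk hp
  have hx : x ≠ 0 := by
    rintro rfl
    norm_num at hk
  have hfrob : (x ^ p - 1) ^ 2 = k * x ^ p := by
    have h := congrArg (frobenius F p) hk
    simp only [map_pow, map_sub, map_mul, map_one, map_intCast] at h
    rwa [frobenius_def] at h
  -- Both `x` and `x ^ p` are roots of `T² - (k + 2) T + 1`, so `x ^ p` is `x` or `x⁻¹`.
  have hconj : (x ^ p - x) * (x ^ (p + 1) - 1) = 0 := by
    linear_combination x * hfrob - x ^ p * hk
  rcases mul_eq_zero.mp hconj with h | h
  · have hpow : x ^ (p - 1) = 1 := by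
      refine mul_right_cancel₀ hx ?_
      rw [pow_sub_one_mul hp.ne_zero, sub_eq_zero.mp h, one_mul]
    exact (orderOf_le_of_pow_eq_one (Nat.sub_pos_of_lt hp.one_lt) hpow).trans (by omega)
  · exact orderOf_le_of_pow_eq_one p.succ_pos (sub_eq_zero.mp h)

/-! ### Norms of cyclotomic values -/

/-- `τ` is a conjugation with norm `N`, as is the nontrivial automorphism of a quadratic order with
its norm to `ℤ`; working with these two maps only, no structure of a number field is needed. -/
def IsConjugation {R : Type*} [CommRing R] (τ : R →+* R) (N : R →* ℤ) : Prop :=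
  ∀ x, (N x : R) = x * τ x

/-- The Lehmer-Pierce sequence `Δ n = N(a ^ n - 1)` of an element `a`, relative to a norm `N`. -/
def pierceSeq {R : Type*} [CommRing R] (N : R →* ℤ) (a : R) (n : ℕ) : ℤ :=
  N (a ^ n - 1)

theorem pierceSeq_dvd_pierceSeq {R : Type*} [CommRing R] (N : R →* ℤ) (a : R) {m n : ℕ}
    (h : m ∣ n) : pierceSeq N a m ∣ pierceSeq N a n :=
  map_dvd N (dvd_pow_sub_one_of_dvd h)

theorem pierceSeq_two_mul {R : Type*} [CommRing R] (N : R →* ℤ) (a : R) (m : ℕ) :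
    pierceSeq N a (2 * m) = pierceSeq N (a ^ 2) m := by
  rw [pierceSeq, pierceSeq, pow_mul]

theorem norm_eval_cyclotomic_dvd_pierceSeq {R : Type*} [CommRing R] (N : R →* ℤ) (a : R)
    (n : ℕ) :
    N ((cyclotomic n R).eval a) ∣ pierceSeq N a n := by
  simpa only [pierceSeq, eval_sub, eval_pow, eval_X, eval_one] using
    map_dvd N (eval_dvd (x := a) (cyclotomic.dvd_X_pow_sub_one n R))

namespace IsConjugation

variable {R : Type u} [CommRing R] {τ : R →+* R} {N : R →* ℤ}

theorem norm_natCast [CharZero R] (h : IsConjugation τ N) (m : ℕ) : N m = m * m := by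
  have hm := h m
  rw [map_natCast τ] at hm
  exact_mod_cast hm

theorem mul_conj_eq_one (h : IsConjugation τ N) {g : R} (hg : N g = 1) : g * τ g = 1 := by
  rw [← h, hg, Int.cast_one]

theorem sub_one_sq (h : IsConjugation τ N) {g : R} (hg : N g = 1) :
    (g - 1) ^ 2 = (-N (g - 1) : ℤ) * g := by
  rw [Int.cast_neg, h, map_sub, map_one]
  linear_combination (g - 1) * h.mul_conj_eq_one hg

theorem dvd_norm_sub_one_iff (h : IsConjugation τ N) {g : R} (hg : N g = 1) {S : Type*}
    [CommRing S] [IsReduced S] {p : ℕ} [CharP S p] (f : R →+* S) :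
    (p : ℤ) ∣ N (g - 1) ↔ f g = 1 := by
  have hsq : (f g - 1) ^ 2 = -(N (g - 1) : S) * f g := by
    simpa using congrArg f (h.sub_one_sq hg)
  rw [← CharP.intCast_eq_zero_iff S p]
  refine ⟨fun h0 ↦ ?_, fun h1 ↦ ?_⟩
  · rw [h0, neg_zero, zero_mul] at hsq
    exact sub_eq_zero.mp (pow_eq_zero_iff two_ne_zero |>.mp hsq)
  · simpa [h1] using hsq

theorem exists_ringHom_field_of_prime_dvd_norm [CharZero R] (h : IsConjugation τ N) {p : ℕ}
    (hp : p.Prime) {x : R} (hx : (p : ℤ) ∣ N x) :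
    ∃ (F : Type u) (_ : Field F) (_ : CharP F p) (f : R →+* F), f x = 0 := by
  have hne : Ideal.span {(p : R)} ≠ ⊤ := by
    rw [Ne, Ideal.span_singleton_eq_top]
    intro hunit
    have hN := hunit.map N
    rw [h.norm_natCast, isUnit_mul_self_iff] at hN
    exact (Nat.prime_iff_prime_int.mp hp).not_isUnit hN
  obtain ⟨I, hI, hpI⟩ := Ideal.exists_le_maximal _ hne
  let := Ideal.Quotient.field I
  let f := Ideal.Quotient.mk I
  have hfp : ((p : ℕ) : R ⧸ I) = 0 := by
    rw [← map_natCast f]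
    exact Ideal.Quotient.eq_zero_iff_mem.mpr (hpI (Ideal.mem_span_singleton_self _))
  have hchar : CharP (R ⧸ I) p := (CharP.charP_iff_prime_eq_zero hp).mpr hfp
  have hnorm : f x * f (τ x) = 0 := by
    rw [← map_mul, ← h, map_intCast]
    exact (CharP.intCast_eq_zero_iff _ p _).mpr hx
  rcases mul_eq_zero.mp hnorm with h0 | h0
  · exact ⟨R ⧸ I, _, hchar, f, h0⟩
  · exact ⟨R ⧸ I, _, hchar, f.comp τ, h0⟩

theorem prime_dvd_pierceSeq_gcd [CharZero R] (h : IsConjugation τ N) {a : R} (ha : N a = 1)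
    {p m n : ℕ} (hp : p.Prime) (hm : (p : ℤ) ∣ pierceSeq N a m) (hn : (p : ℤ) ∣ pierceSeq N a n) :
    (p : ℤ) ∣ pierceSeq N a (m.gcd n) := by
  obtain ⟨F, _, _, f, -⟩ := h.exists_ringHom_field_of_prime_dvd_norm hp hm
  have hiff : ∀ k, (p : ℤ) ∣ pierceSeq N a k ↔ f a ^ k = 1 := fun k ↦ by
    rw [← map_pow]
    exact h.dvd_norm_sub_one_iff (by rw [map_pow, ha, one_pow]) f
  rw [hiff] at *
  exact pow_gcd_eq_one.mpr ⟨hm, hn⟩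

theorem pierceSeq_ne_zero (h : IsConjugation τ N) {a : R} (ha : N a = 1 ∨ N a = -1) (σ : R →+* ℝ)
    (hpos : 0 < σ a) (hne : σ a ≠ 1) {n : ℕ} (hn : n ≠ 0) : pierceSeq N a n ≠ 0 := by
  intro h0
  have hnorm : σ a * σ (τ a) = N a := by
    rw [← map_mul, ← h, map_intCast]
  have hprod : (σ a ^ n - 1) * (σ (τ a) ^ n - 1) = 0 := by
    simpa [show N (a ^ n - 1) = 0 from h0] using (congrArg σ (h (a ^ n - 1))).symm
  rcases mul_eq_zero.mp hprod with hroot | hroot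
  · exact hne ((pow_eq_one_iff_of_nonneg hpos.le hn).mp (sub_eq_zero.mp hroot))
  · have hsq : (σ a ^ 2) ^ n = 1 := calc
      (σ a ^ 2) ^ n = ((σ a * σ (τ a)) ^ 2) ^ n := by
        rw [mul_pow, mul_pow, pow_right_comm (σ (τ a)), sub_eq_zero.mp hroot, one_pow, mul_one]
      _ = 1 := by rcases ha with ha | ha <;> simp [hnorm, ha]
    rw [← pow_mul, pow_eq_one_iff_of_nonneg hpos.le (by positivity)] at hsq
    exact hne hsq

theorem dvd_of_isPrimitivePrimeDivisor (h : IsConjugation τ N) {a : R} (ha : N a = 1)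
    (σ : R →+* ℝ) (hpos : 0 < σ a) (hne : σ a ≠ 1) {p m n : ℕ} (hn : n ≠ 0)
    (hp : IsPrimitivePrimeDivisor (pierceSeq N a) n p) (hm : (p : ℤ) ∣ pierceSeq N a m) :
    n ∣ m := by
  have := σ.charZero
  have hgcd := Nat.gcd_pos_of_pos_right m (Nat.pos_of_ne_zero hn)
  by_contra hnm
  have hlt : m.gcd n < n := (Nat.gcd_le_right m (Nat.pos_of_ne_zero hn)).lt_of_ne
    fun heq ↦ hnm (Nat.gcd_eq_right_iff_dvd.mp heq)
  exact hp.2.2 _ hgcd hlt (h.pierceSeq_ne_zero (Or.inl ha) σ hpos hne hgcd.ne')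
    (h.prime_dvd_pierceSeq_gcd ha hp.1 hm hp.2.1)

theorem not_pow_three_dvd_norm_geom_sum [CharZero R] (h : IsConjugation τ N) {e : R}
    (he : N e = 1) {p j : ℕ} (hp : p.Prime) (hpe : (p : ℤ) ∣ N (e - 1)) (hj : 4 < p ^ (j + 1)) :
    ¬ (p : ℤ) ^ 3 ∣ N (∑ i ∈ Finset.range p, (e ^ p ^ j) ^ i) := by
  have hdvd : (p : R) ∣ (e - 1) ^ 2 := by
    rw [h.sub_one_sq he]
    exact_mod_cast ((Int.cast_dvd_cast (p : ℤ) _ hpe.neg_right).mul_right e : ((p : ℤ) : R) ∣ _)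
  obtain ⟨w, hw, hsum⟩ := exists_mem_span_geom_sum_eq hp hdvd hj
  have hp0 : (p : ℤ) * p ≠ 0 := by
    have := hp.ne_zero
    positivity
  rw [hsum, map_mul, h.norm_natCast, show (p : ℤ) ^ 3 = p * p * p by ring,
    mul_dvd_mul_iff_left hp0]
  intro hdvd'
  obtain ⟨F, _, _, f, hf⟩ := h.exists_ringHom_field_of_prime_dvd_norm hp hdvd'
  have hspan : Ideal.span {(p : R), e - 1} ≤ RingHom.ker f := by
    rw [Ideal.span_le, Set.pair_subset_iff]
    refine ⟨?_, ?_⟩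
    · simp [RingHom.mem_ker]
    · simp [RingHom.mem_ker, (h.dvd_norm_sub_one_iff he f).mp hpe]
  rw [map_add, map_one, RingHom.mem_ker.mp (hspan hw), add_zero] at hf
  exact one_ne_zero hf

theorem exists_isPrimitiveRoot_ordCompl [CharZero R] (h : IsConjugation τ N) {a : R} {p n : ℕ}
    (hp : p.Prime) (hn : n ≠ 0) (hdvd : (p : ℤ) ∣ N ((cyclotomic n R).eval a)) :
    ∃ (F : Type u) (_ : Field F) (_ : CharP F p) (f : R →+* F),
      IsPrimitiveRoot (f a) (ordCompl[p] n) := by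
  obtain ⟨F, hF, hchar, f, hf⟩ := h.exists_ringHom_field_of_prime_dvd_norm hp hdvd
  refine ⟨F, hF, hchar, f, isPrimitiveRoot_ordCompl_of_isRoot_cyclotomic hp hn ?_⟩
  rwa [IsRoot, cyclotomic.eval_apply]

theorem prime_dvd_pierceSeq_iff [CharZero R] (h : IsConjugation τ N) {a : R} (ha : N a = 1)
    {p n : ℕ} (hp : p.Prime) (hn : n ≠ 0) (hdvd : (p : ℤ) ∣ N ((cyclotomic n R).eval a)) (m : ℕ) :
    (p : ℤ) ∣ pierceSeq N a m ↔ ordCompl[p] n ∣ m := by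
  obtain ⟨F, _, _, f, hroot⟩ := h.exists_isPrimitiveRoot_ordCompl hp hn hdvd
  rw [← hroot.pow_eq_one_iff_dvd, ← map_pow]
  exact h.dvd_norm_sub_one_iff (by rw [map_pow, ha, one_pow]) f

theorem ordCompl_le_add_one [CharZero R] (h : IsConjugation τ N) {a : R} (ha : N a = 1) {p n : ℕ}
    (hp : p.Prime) (hn : n ≠ 0) (hdvd : (p : ℤ) ∣ N ((cyclotomic n R).eval a)) :
    ordCompl[p] n ≤ p + 1 := by
  obtain ⟨F, _, _, f, hroot⟩ := h.exists_isPrimitiveRoot_ordCompl hp hn hdvd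
  rw [hroot.eq_orderOf]
  refine orderOf_le_add_one_of_sub_one_sq_eq hp (k := -N (a - 1)) ?_
  simpa using congrArg f (h.sub_one_sq ha)

theorem dvd_of_not_hasPrimitivePrimeDivisor [CharZero R] (h : IsConjugation τ N) {a : R}
    (ha : N a = 1) {p n : ℕ} (hp : p.Prime) (hn : n ≠ 0)
    (hdvd : (p : ℤ) ∣ N ((cyclotomic n R).eval a))
    (hnot : ¬ HasPrimitivePrimeDivisor (pierceSeq N a) n) : p ∣ n := by
  by_contra hpn
  refine hnot ⟨p, hp, hdvd.trans (norm_eval_cyclotomic_dvd_pierceSeq N a n),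
    fun m hm hmn _ hdvd_m ↦ ?_⟩
  rw [h.prime_dvd_pierceSeq_iff ha hp hn hdvd,
    (Nat.ordCompl_eq_self_iff_zero_or_not_dvd n hp).mpr (Or.inr hpn)] at hdvd_m
  exact hmn.not_ge (Nat.le_of_dvd hm hdvd_m)

theorem not_pow_three_dvd_norm_eval_cyclotomic [CharZero R] (h : IsConjugation τ N) {a : R}
    (ha : N a = 1) {p n : ℕ} (hn : 12 < n) (hp : p.Prime) (hpn : p ∣ n)
    (hdvd : (p : ℤ) ∣ N ((cyclotomic n R).eval a)) :
    ¬ (p : ℤ) ^ 3 ∣ N ((cyclotomic n R).eval a) := by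
  have hn0 : n ≠ 0 := by omega
  obtain ⟨j, hj⟩ : ∃ j, n.factorization p = j + 1 :=
    Nat.exists_eq_succ_of_ne_zero (hp.factorization_pos_of_dvd hn0 hpn).ne'
  have hproj := four_lt_ordProj hn hp hpn (h.ordCompl_le_add_one ha hp hn0 hdvd)
  rw [hj] at hproj
  have hfactor : n = ordCompl[p] n * p ^ j * p := by
    rw [mul_assoc, ← pow_succ, ← hj, mul_comm, Nat.ordProj_mul_ordCompl_eq_self]
  have hpe : (p : ℤ) ∣ N (a ^ ordCompl[p] n - 1) :=
    (h.prime_dvd_pierceSeq_iff ha hp hn0 hdvd _).mpr dvd_rfl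
  have hsum := cyclotomic_mul_dvd_geom_sum R
    (Nat.mul_pos (Nat.ordCompl_pos p hn0) (pow_pos hp.pos j)) hp.one_lt
  rw [← hfactor] at hsum
  have heval : (cyclotomic n R).eval a ∣
      ∑ i ∈ Finset.range p, ((a ^ ordCompl[p] n) ^ p ^ j) ^ i := by
    simpa only [eval_finsetSum, eval_pow, eval_X, pow_mul] using eval_dvd (x := a) hsum
  exact fun h3 ↦ h.not_pow_three_dvd_norm_geom_sum (by rw [map_pow, ha, one_pow]) hp hpe hproj
    (h3.trans (map_dvd N heval))

theorem thirteen_div_five_le_of_one_lt (h : IsConjugation τ N) {a : R} (ha : N a = 1) (σ : R →+* ℝ)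
    (hσ : 1 < σ a) : 13 / 5 ≤ σ a := by
  have hsq : (σ a - 1) ^ 2 = (-N (a - 1) : ℤ) * σ a := by
    simpa using congrArg σ (h.sub_one_sq ha)
  have hk : 0 < -N (a - 1) := by
    have : (0 : ℝ) < (-N (a - 1) : ℤ) :=
      pos_of_mul_pos_left (hsq ▸ pow_pos (sub_pos.mpr hσ) 2) (by linarith)
    exact_mod_cast this
  have hk1 : (1 : ℝ) ≤ (-N (a - 1) : ℤ) := by exact_mod_cast hk
  -- `13 / 5` lies below `(3 + √5) / 2`, the root greater than `1` of `(x - 1) ^ 2 = x`.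
  nlinarith

theorem pow_totient_div_five_lt_abs_norm_eval_cyclotomic (h : IsConjugation τ N) {a : R}
    (ha : N a = 1) (σ : R →+* ℝ) (hpos : 0 < σ a) (hne : σ a ≠ 1) {n : ℕ} (hn : 0 < n) :
    (13 / 5 : ℝ) ^ n.totient / 5 < |(N ((cyclotomic n R).eval a) : ℝ)| := by
  have hmul : σ a * σ (τ a) = 1 := by rw [← map_mul, h.mul_conj_eq_one ha, map_one]
  wlog hσ : 1 < σ a generalizing σ
  · have hlt : σ a < 1 := (not_lt.mp hσ).lt_of_ne hne
    have hinv : (σ.comp τ) a = (σ a)⁻¹ := eq_inv_of_mul_eq_one_right hmul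
    have hgt : 1 < (σ.comp τ) a := by
      rw [hinv]
      exact (one_lt_inv₀ hpos).mpr hlt
    refine this (σ.comp τ) (by linarith) hgt.ne' ?_ hgt
    rw [← map_mul, h.mul_conj_eq_one ha, map_one]
  have hnorm : (N ((cyclotomic n R).eval a) : ℝ) =
      (cyclotomic n ℝ).eval (σ a) * (cyclotomic n ℝ).eval (σ a)⁻¹ := by
    rw [← eq_inv_of_mul_eq_one_right hmul, cyclotomic.eval_apply, cyclotomic.eval_apply,
      cyclotomic.eval_apply, ← map_mul, ← h, map_intCast]
  rw [hnorm]
  exact pow_totient_div_five_lt_abs_eval_cyclotomic_mul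
    (h.thirteen_div_five_le_of_one_lt ha σ hσ) hn

theorem totient_add_one_sq_lt_natAbs_norm_eval_cyclotomic (h : IsConjugation τ N) {a : R}
    (ha : N a = 1) (σ : R →+* ℝ) (hpos : 0 < σ a) (hne : σ a ≠ 1) {n : ℕ} (hn : 12 < n) :
    (n.totient + 1) ^ 2 < (N ((cyclotomic n R).eval a)).natAbs := by
  have hlt := (add_one_sq_lt_pow_div_five (six_le_totient hn)).trans
    (h.pow_totient_div_five_lt_abs_norm_eval_cyclotomic ha σ hpos hne (by omega : 0 < n))
  rw [← Int.cast_abs, Int.abs_eq_natAbs] at hlt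
  exact_mod_cast hlt

theorem natAbs_norm_eval_cyclotomic_dvd_sq [CharZero R] (h : IsConjugation τ N) {a : R}
    (ha : N a = 1) {p n : ℕ} (hn : 12 < n) (hp : p.Prime)
    (hdvd : p ∣ (N ((cyclotomic n R).eval a)).natAbs)
    (hnot : ¬ HasPrimitivePrimeDivisor (pierceSeq N a) n) :
    (N ((cyclotomic n R).eval a)).natAbs ∣ p ^ 2 := by
  have hn0 : n ≠ 0 := by omega
  set M := (N ((cyclotomic n R).eval a)).natAbs with hM
  have hdvd_n : ∀ q : ℕ, q.Prime → q ∣ M → q ∣ n ∧ ordCompl[q] n ≤ q + 1 := fun q hq hqM ↦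
    have hqN := Int.natCast_dvd.mpr hqM
    ⟨h.dvd_of_not_hasPrimitivePrimeDivisor ha hq hn0 hqN hnot,
      h.ordCompl_le_add_one ha hq hn0 hqN⟩
  obtain ⟨hpn, hpr⟩ := hdvd_n p hp hdvd
  have hcube : ¬ p ^ 3 ∣ M := by
    rw [hM, ← Int.natCast_dvd, Nat.cast_pow]
    exact h.not_pow_three_dvd_norm_eval_cyclotomic ha hn hp hpn (Int.natCast_dvd.mpr hdvd)
  have hM0 : M ≠ 0 := fun h0 ↦ hcube (h0 ▸ dvd_zero _)
  have hMpow : M = p ^ M.primeFactorsList.length :=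
    Nat.eq_prime_pow_of_unique_prime_dvd hM0 fun {q} hq hqM ↦
      have ⟨hqn, hqr⟩ := hdvd_n q hq hqM
      eq_of_ordCompl_le_add_one hn hq hp hqn hpn hqr hpr
  rw [hMpow] at hcube ⊢
  exact pow_dvd_pow p (not_lt.mp fun hlen ↦ hcube (pow_dvd_pow p hlen))

theorem hasPrimitivePrimeDivisor_of_norm_eq_one (h : IsConjugation τ N) {a : R}
    (ha : N a = 1) (σ : R →+* ℝ) (hpos : 0 < σ a) (hne : σ a ≠ 1) {n : ℕ} (hn : 12 < n) :
    HasPrimitivePrimeDivisor (pierceSeq N a) n := by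
  have := σ.charZero
  by_contra hnot
  have hbound := h.totient_add_one_sq_lt_natAbs_norm_eval_cyclotomic ha σ hpos hne hn
  have hM1 : (N ((cyclotomic n R).eval a)).natAbs ≠ 1 :=
    ((Nat.one_le_pow 2 _ n.totient.succ_pos).trans_lt hbound).ne'
  obtain ⟨p, hp, hpM⟩ := Nat.exists_prime_and_dvd hM1
  have hpn : p ∣ n := h.dvd_of_not_hasPrimitivePrimeDivisor ha hp (by omega)
    (Int.natCast_dvd.mpr hpM) hnot
  have hp_le : p ≤ n.totient + 1 := by
    have hle := Nat.le_of_dvd (Nat.totient_pos.mpr (by omega)) (Nat.totient_dvd_of_dvd hpn)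
    rw [Nat.totient_prime hp] at hle
    omega
  exact hbound.not_ge <| calc
    (N ((cyclotomic n R).eval a)).natAbs
    _ ≤ p ^ 2 := Nat.le_of_dvd (pow_pos hp.pos 2)
      (h.natAbs_norm_eval_cyclotomic_dvd_sq ha hn hp hpM hnot)
    _ ≤ (n.totient + 1) ^ 2 := Nat.pow_le_pow_left hp_le 2

theorem pierceSeq_two_mul_of_odd [CharZero R] (h : IsConjugation τ N) {a : R} (ha : N a = -1)
    {m : ℕ} (hm : Odd m) : pierceSeq N a (2 * m) = -pierceSeq N a m ^ 2 := by
  have hconj : a ^ m * τ a ^ m = -1 := by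
    rw [← mul_pow, ← h, ha, Int.cast_neg, Int.cast_one, hm.neg_one_pow]
  have hcast : ((pierceSeq N a (2 * m) : ℤ) : R) = (-pierceSeq N a m ^ 2 : ℤ) := by
    rw [Int.cast_neg, Int.cast_pow, pierceSeq, pierceSeq, h, h, mul_comm 2 m, pow_mul]
    simp only [map_sub, map_pow, map_one]
    linear_combination 2 * (a ^ m - 1) * (τ a ^ m - 1) * hconj
  exact_mod_cast hcast

theorem prime_dvd_pierceSeq_two_mul_iff_of_odd [CharZero R] (h : IsConjugation τ N) {a : R}
    (ha : N a = -1) {p m : ℕ} (hp : p.Prime) (hm : Odd m) :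
    (p : ℤ) ∣ pierceSeq N a (2 * m) ↔ (p : ℤ) ∣ pierceSeq N a m := by
  rw [h.pierceSeq_two_mul_of_odd ha hm, dvd_neg,
    (Nat.prime_iff_prime_int.mp hp).dvd_pow_iff_dvd two_ne_zero]

theorem exists_prime_dvd_pierceSeq_two_mul (h : IsConjugation τ N) {a : R}
    (ha : N a = -1) (σ : R →+* ℝ) (hpos : 0 < σ a) (hne : σ a ≠ 1) {n : ℕ} (hn : 12 < n) :
    ∃ p : ℕ, p.Prime ∧ (p : ℤ) ∣ pierceSeq N a (2 * n) ∧
      ∀ m, (p : ℤ) ∣ pierceSeq N a (2 * m) → n ∣ m := by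
  have ha2 : N (a ^ 2) = 1 := by rw [map_pow, ha, neg_one_sq]
  have hpos2 : 0 < σ (a ^ 2) := by
    rw [map_pow]
    exact pow_pos hpos 2
  have hne2 : σ (a ^ 2) ≠ 1 := by
    rw [map_pow]
    exact mt (pow_eq_one_iff_of_nonneg hpos.le two_ne_zero).mp hne
  obtain ⟨p, hp⟩ := h.hasPrimitivePrimeDivisor_of_norm_eq_one ha2 σ hpos2 hne2 hn
  simp only [pierceSeq_two_mul]
  exact ⟨p, hp.1, hp.2.1, fun m ↦
    h.dvd_of_isPrimitivePrimeDivisor ha2 σ hpos2 hne2 (by omega) hp⟩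

theorem not_hasPrimitivePrimeDivisor_two_mul_of_odd (h : IsConjugation τ N) {a : R}
    (ha : N a = -1) (σ : R →+* ℝ) (hpos : 0 < σ a) (hne : σ a ≠ 1) {n : ℕ} (hn : Odd n) :
    ¬ HasPrimitivePrimeDivisor (pierceSeq N a) (2 * n) := by
  have := σ.charZero
  rintro ⟨p, hp, hdvd, hprim⟩
  have hn0 := hn.pos
  exact hprim n hn0 (by omega) (h.pierceSeq_ne_zero (Or.inr ha) σ hpos hne hn0.ne')
    ((h.prime_dvd_pierceSeq_two_mul_iff_of_odd ha hp hn).mp hdvd)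

theorem hasPrimitivePrimeDivisor_of_odd (h : IsConjugation τ N) {a : R}
    (ha : N a = -1) (σ : R →+* ℝ) (hpos : 0 < σ a) (hne : σ a ≠ 1) {n : ℕ} (hn : 12 < n)
    (hodd : Odd n) : HasPrimitivePrimeDivisor (pierceSeq N a) n := by
  have := σ.charZero
  obtain ⟨p, hp, hdvd, hrank⟩ := h.exists_prime_dvd_pierceSeq_two_mul ha σ hpos hne hn
  refine ⟨p, hp, (h.prime_dvd_pierceSeq_two_mul_iff_of_odd ha hp hodd).mp hdvd,
    fun m hm hmn _ hm_dvd ↦ ?_⟩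
  have hnm := hrank m (hm_dvd.trans (pierceSeq_dvd_pierceSeq N a (dvd_mul_left m 2)))
  exact hmn.not_ge (Nat.le_of_dvd hm hnm)

theorem hasPrimitivePrimeDivisor_two_mul_of_even (h : IsConjugation τ N) {a : R}
    (ha : N a = -1) (σ : R →+* ℝ) (hpos : 0 < σ a) (hne : σ a ≠ 1) {n : ℕ} (hn : 12 < n)
    (heven : Even n) : HasPrimitivePrimeDivisor (pierceSeq N a) (2 * n) := by
  obtain ⟨p, hp, hdvd, hrank⟩ := h.exists_prime_dvd_pierceSeq_two_mul ha σ hpos hne hn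
  refine ⟨p, hp, hdvd, fun m hm hmn _ hm_dvd ↦ ?_⟩
  have hnm := hrank m (hm_dvd.trans (pierceSeq_dvd_pierceSeq N a (dvd_mul_left m 2)))
  obtain ⟨d, rfl⟩ := (heven.trans_dvd hnm).two_dvd
  have hnd := Nat.le_of_dvd (by omega) (hrank d hm_dvd)
  omega

theorem not_hasPrimitivePrimeDivisor_iff_of_norm_eq_neg_one (h : IsConjugation τ N)
    {a : R} (ha : N a = -1) (σ : R →+* ℝ) (hpos : 0 < σ a) (hne : σ a ≠ 1) {n : ℕ}
    (hn : 24 < n) : ¬ HasPrimitivePrimeDivisor (pierceSeq N a) n ↔ n ≡ 2 [MOD 4] := by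
  rcases n.even_or_odd' with ⟨m, rfl | rfl⟩
  · rcases m.even_or_odd with hm | hm
    · have hmod : ¬ 2 * m ≡ 2 [MOD 4] := by
        obtain ⟨c, rfl⟩ := hm
        simp only [Nat.ModEq]
        omega
      exact iff_of_false (not_not.mpr <|
        h.hasPrimitivePrimeDivisor_two_mul_of_even ha σ hpos hne (by omega) hm) hmod
    · have hmod : 2 * m ≡ 2 [MOD 4] := by
        obtain ⟨c, rfl⟩ := hm
        simp only [Nat.ModEq]
        omega
      exact iff_of_true (h.not_hasPrimitivePrimeDivisor_two_mul_of_odd ha σ hpos hne hm) hmod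
  · have hmod : ¬ 2 * m + 1 ≡ 2 [MOD 4] := by
      simp only [Nat.ModEq]
      omega
    exact iff_of_false (not_not.mpr <|
      h.hasPrimitivePrimeDivisor_of_odd ha σ hpos hne (by omega) (odd_two_mul_add_one m)) hmod

end IsConjugation

theorem exists_isConjugation_of_finrank_eq_two {K : Type*} [Field K] [NumberField K]
    (hK : Module.finrank ℚ K = 2) :
    ∃ τ : 𝓞 K →+* 𝓞 K, IsConjugation τ (Algebra.norm ℤ) := by
  classical
  have : Algebra.IsQuadraticExtension ℚ K := ⟨hK⟩
  have hcard : Fintype.card (K ≃ₐ[ℚ] K) = 2 := by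
    rw [← Nat.card_eq_fintype_card, IsGalois.card_aut_eq_finrank, hK]
  obtain ⟨s, hs⟩ := Fintype.exists_ne_of_one_lt_card (by omega) (1 : K ≃ₐ[ℚ] K)
  have huniv : (Finset.univ : Finset (K ≃ₐ[ℚ] K)) = {1, s} := by
    refine (Finset.eq_of_subset_of_card_le (Finset.subset_univ _) ?_).symm
    rw [Finset.card_univ, hcard, Finset.card_pair hs.symm]
  refine ⟨NumberField.RingOfIntegers.mapRingHom (s : K →+* K), fun x ↦ ?_⟩
  apply NumberField.RingOfIntegers.ext
  have hnorm := Algebra.norm_eq_prod_automorphisms ℚ (x : K)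
  rw [huniv, Finset.prod_pair hs.symm, ← Algebra.coe_norm_int] at hnorm
  simpa using hnorm

theorem theorem1p4_general {R : Type*} [CommRing R] {τ : R →+* R} {N : R →* ℤ}
    (h : IsConjugation τ N) (σ : R →+* ℝ) {a : R} (hpos : 0 < σ a) (hne : σ a ≠ 1) :
    (N a = 1 → ∀ n, 12 < n → HasPrimitivePrimeDivisor (pierceSeq N a) n) ∧
      (N a = -1 → ∀ n, 24 < n →
        (¬ HasPrimitivePrimeDivisor (pierceSeq N a) n ↔ n ≡ 2 [MOD 4])) :=
  ⟨fun ha _ ↦ h.hasPrimitivePrimeDivisor_of_norm_eq_one ha σ hpos hne,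
    fun ha _ ↦ h.not_hasPrimitivePrimeDivisor_iff_of_norm_eq_neg_one ha σ hpos hne⟩

/-- `K` is a real quadratic field, viewed in `ℝ` through the embedding `σ`. -/
theorem theorem1p4 {K : Type*} [Field K] [NumberField K] (hK : Module.finrank ℚ K = 2)
    (σ : K →+* ℝ) (α : (𝓞 K)ˣ) (hα_one : α ≠ 1) (hα_neg_one : α ≠ -1)
    (hα_pos : 0 < σ ((α : 𝓞 K) : K)) :
    (Algebra.norm ℚ ((α : 𝓞 K) : K) = 1 →
      ∀ n : ℕ, 12 < n → HasPrimitivePrimeDivisor (lehmerPierce (α : 𝓞 K)) n) ∧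
    (Algebra.norm ℚ ((α : 𝓞 K) : K) = -1 →
      ∀ n : ℕ, 24 < n →
        (¬ HasPrimitivePrimeDivisor (lehmerPierce (α : 𝓞 K)) n ↔ n ≡ 2 [MOD 4])) := by
  obtain ⟨τ, h⟩ := exists_isConjugation_of_finrank_eq_two hK
  have hne : σ (α : 𝓞 K) ≠ 1 := fun h1 ↦ hα_one <| Units.ext <|
    NumberField.RingOfIntegers.ext <| σ.injective <| h1.trans (map_one σ).symm
  rw [← Algebra.coe_norm_int]
  exact_mod_cast theorem1p4_general h (σ.comp (algebraMap (𝓞 K) K)) hα_pos hne
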